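/- Let $k$ be a field of characteristic different from $2$ and $3$, with algebraic closure $\bar k$, and let $S\in k[t]$ be a polynomial of degree $6$ or $5$ without repeated roots in $\bar k$. Let $\mathcal E$ be the elliptic curve $y^2=x^3+S(t)$ over $\bar k(t)$. For $f\in\bar k(t)$ let $\deg f$ denote its degree as a rational map to $\mathbf P^1$, i.e. $\deg f=\max(\deg p,\deg q)$ if $f=p/q$ in lowest terms, so that constants have degree $0$. Define the naive height $h:\mathcal E(\bar k(t))\to\mathbf Q$ by $h(0)=0$ and $h((x,y))=\max(\deg x,\tfrac23\deg y)$. Then there is exactly one quadratic form $\hat h:\mathcal E(\bar k(t))\to\mathbf R$ for which $\hat h-h$ is bounded (the canonical, or Néron–Tate, height), and for every nonzero point $P=(x,y)\in\mathcal E(\bar k(t))$ $$\hat h(P)=\max\bigl(\deg x,\tfrac23\deg y\bigr);$$ that is, the naive and canonical heights on $\mathcal E(\bar k(t))$ are equal. -/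

import Mathlib

open Polynomial

noncomputable section

/-- The degree of a rational function `f ∈ K(t)` considered as a rational map to `ℙ¹`: writing
`f = p / q` in lowest terms, it is `max (deg p) (deg q)`; it is `0` for constant `f`. -/
def ratFuncMapDegree {K : Type*} [Field K] (f : RatFunc K) : ℕ :=
  max f.num.natDegree f.denom.natDegree

/-- The naive height on the `K(t)`-rational points of a Weierstrass curve over `K(t)`: the zero
point has height `0`, and `(x, y)` has height `max (deg x) ((2/3) deg y)`. -/
def naiveHeight {K : Type*} [Field K] (W : WeierstrassCurve.Affine (RatFunc K)) : W.Point → ℝ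
  | .zero => 0
  | .some x y _ => max (ratFuncMapDegree x : ℝ) ((2 / 3 : ℝ) * (ratFuncMapDegree y : ℝ))

/-- A quadratic form on the group of `K(t)`-rational points of a Weierstrass curve over `K(t)` is
the canonical (Néron–Tate) height if it differs from the naive height by a bounded function. -/
def IsCanonicalHeight {K : Type*} [Field K] [DecidableEq (RatFunc K)]
    (W : WeierstrassCurve.Affine (RatFunc K)) (hhat : QuadraticMap ℤ W.Point ℝ) : Prop :=
  ∃ C : ℝ, ∀ P : W.Point, |hhat P - naiveHeight W P| ≤ C

/-- The curve `y² = x³ + S(t)` over `K(t)`, for a polynomial `S` with coefficients in a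
field `k` of which `K` is an extension. -/
def sexticCurve {k : Type*} [Field k] (K : Type*) [Field K] [Algebra k K] (S : k[X]) :
    WeierstrassCurve.Affine (RatFunc K) where
  a₁ := 0
  a₂ := 0
  a₃ := 0
  a₄ := 0
  a₆ := algebraMap K[X] (RatFunc K) (S.map (algebraMap k K))

end

/-! The naive height satisfies the parallelogram law exactly, so it is itself a quadratic form, and
a bounded quadratic form vanishes, which gives uniqueness. Write `x(P) = a / b` in lowest terms and
regard `a, b` as forms on the projective line of weights `h, h - 2` without common zero; the least
such `h` is the naive height (`max_ratFuncMapDegree_eq`). The elementary symmetric functions of `x(P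
+ Q)` and `x(P - Q)` then have two projective descriptions: by products of their own coordinates, of
weight `h(P + Q) + h(P - Q)`, and by polynomials in those of `P` and `Q`, of weight `2 h(P) + 2
h(Q)`. If neither triple has a common zero, the weights agree. For the second triple this is
`isNormalizedTriple_addSub`: a common zero forces both points to reduce to the cusp of a singular
fibre, which cannot happen because `S` has only simple zeros, counting infinity in degree 5. -/

open Polynomial

/-! ### Quadratic forms and the parallelogram law -/

section QuadraticOfParallelogram

variable {M : Type*} [AddCommGroup M]

/-- A real-valued function on an abelian group satisfying the parallelogram law is a
quadratic form over `ℤ`. -/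
theorem exists_quadraticMap_of_parallelogram (f : M → ℝ)
    (hf : ∀ x y, f (x + y) + f (x - y) = 2 * f x + 2 * f y) :
    ∃ q : QuadraticMap ℤ M ℝ, ∀ x, q x = f x := by
  have f0 : f 0 = 0 := by have := hf 0 0; simp at this; linarith
  -- Jordan–von Neumann: `e1 - e2` eliminates `f (x - y + z)`; two further instances of the law
  -- eliminate `f (x + y - z)` and `f (y - z)`.
  have hadd : ∀ x y z, f (x + y + z) - f (x + y) - f z =
      (f (x + z) - f x - f z) + (f (y + z) - f y - f z) := fun x y z ↦ by
    have e1 := hf (x + z) y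
    have e2 := hf x (y - z)
    rw [show x + z + y = x + y + z by abel, show x + z - y = x - y + z by abel] at e1
    rw [show x + (y - z) = x + y - z by abel, show x - (y - z) = x - y + z by abel] at e2
    linarith [hf y z, hf (x + y) z]
  let B : M →+ M →+ ℝ := AddMonoidHom.mk' (fun x ↦ AddMonoidHom.mk'
    (fun y ↦ f (x + y) - f x - f y) (fun y z ↦ by
      have := hadd y z x
      rw [show x + (y + z) = y + z + x by abel, add_comm x y, add_comm x z]
      linarith)) (fun x y ↦ by
      ext z
      have := hadd x y z
      simp only [AddMonoidHom.mk'_apply, AddMonoidHom.add_apply]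
      linarith)
  have hB : ∀ x y, B x y = f (x + y) - f x - f y := fun _ _ ↦ rfl
  have hBself : ∀ x, B x x = 2 * f x := fun x ↦ by
    have := hf x x
    rw [sub_self, f0] at this
    rw [hB]; linarith
  let L : LinearMap.BilinMap ℤ M ℝ :=
    LinearMap.mk₂ ℤ (fun x y ↦ B x y) (fun x y z ↦ by simp)
      (fun c x y ↦ by simp) (fun x y z ↦ by simp) (fun c x y ↦ by simp)
  refine ⟨⟨f, fun a x ↦ ?_, L, fun x y ↦ ?_⟩, fun _ ↦ rfl⟩
  · have := hBself (a • x)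
    simp only [map_zsmul, AddMonoidHom.smul_apply, hBself, smul_smul] at this
    simp only [zsmul_eq_mul] at this ⊢
    linarith
  · change f (x + y) = f x + f y + B x y
    rw [hB]; ring

/-- A quadratic form over `ℤ` with bounded real values vanishes. -/
theorem QuadraticMap.eq_zero_of_bounded (q : QuadraticMap ℤ M ℝ) (C : ℝ)
    (hC : ∀ x, |q x| ≤ C) (x : M) : q x = 0 := by
  by_contra hne
  have hpos : 0 < |q x| := abs_pos.mpr hne
  obtain ⟨n, hn⟩ := exists_nat_gt (C / |q x|)
  have h1 := hC ((n + 1 : ℤ) • x)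
  rw [QuadraticMap.map_smul, zsmul_eq_mul, abs_mul] at h1
  push_cast at h1
  rw [abs_of_nonneg (by positivity : (0 : ℝ) ≤ ((n : ℝ) + 1) * (n + 1))] at h1
  rw [div_lt_iff₀ hpos] at hn
  nlinarith [mul_nonneg (Nat.cast_nonneg (α := ℝ) n) hpos.le,
    mul_nonneg (mul_self_nonneg (n : ℝ)) hpos.le]

end QuadraticOfParallelogram

/-! ### Addition formulas for `x`-coordinates -/

section AddSub

open WeierstrassCurve.Affine

variable {F : Type*} [Field F] [DecidableEq F]

/-- The projective `x`-coordinates of `P + Q` and `P - Q` on `y² = x³ + B` in terms of those of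
`P` and `Q`. -/
theorem exists_mul_xRep_add_sub (W : WeierstrassCurve.Affine F) (h₁ : W.a₁ = 0) (h₂ : W.a₂ = 0)
    (h₃ : W.a₃ = 0) (h₄ : W.a₄ = 0) (P Q : W.Point) :
    ∃ κ : F,
      κ * ((P + Q).xRep 1 * (P - Q).xRep 1) =
        (P.xRep 0 * Q.xRep 1 - Q.xRep 0 * P.xRep 1) ^ 2 ∧
      κ * ((P + Q).xRep 0 * (P - Q).xRep 1 + (P - Q).xRep 0 * (P + Q).xRep 1) =
        2 * (P.xRep 0 * Q.xRep 0 * (P.xRep 0 * Q.xRep 1 + Q.xRep 0 * P.xRep 1) +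
          2 * W.a₆ * P.xRep 1 ^ 2 * Q.xRep 1 ^ 2) ∧
      κ * ((P + Q).xRep 0 * (P - Q).xRep 0) =
        P.xRep 0 ^ 2 * Q.xRep 0 ^ 2 - 4 * W.a₆ * P.xRep 1 * Q.xRep 1 *
          (P.xRep 0 * Q.xRep 1 + Q.xRep 0 * P.xRep 1) := by
  have double : ∀ (x y : F) (h : W.Nonsingular x y),
      ∃ κ : F, κ * (Point.some x y h +
          Point.some x y h).xRep 1 = 4 * (x ^ 3 + W.a₆) ∧
        κ * (Point.some x y h +
          Point.some x y h).xRep 0 = x ^ 4 - 8 * W.a₆ * x := by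
    intro x y h
    have heq := (W.equation_iff x y).mp h.1
    simp only [h₁, h₂, h₃, h₄, zero_mul, add_zero] at heq
    by_cases hy : y = W.negY x y
    · rw [Point.add_self_of_Y_eq hy]
      simp only [negY, h₁, h₃, zero_mul, sub_zero] at hy
      -- The double is zero, with coordinates `(1 : 0)`, so the factor is the second form itself.
      refine ⟨x ^ 4 - 8 * W.a₆ * x, ?_, ?_⟩
      · simp only [Point.xRep_zero, Matrix.cons_val_one,
          Matrix.cons_val_fin_one, mul_zero]
        linear_combination 4 * heq - 2 * y * hy
      · simp
    · rw [Point.add_self_of_Y_ne hy]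
      have hsl := slope_of_Y_ne rfl hy
      simp only [negY, h₁, h₂, h₃, h₄, zero_mul, sub_zero, mul_zero,
        add_zero] at hy hsl
      have hy' : y - -y ≠ 0 := sub_ne_zero.mpr hy
      refine ⟨(y - -y) ^ 2, ?_, ?_⟩
      · simp; linear_combination 4 * heq
      · simp only [Point.xRep_some, Matrix.cons_val_zero,
          addX, h₁, h₂, hsl, zero_mul, add_zero, sub_zero]
        have hz : (y - -y) ^ 2 = 4 * (x ^ 3 + W.a₆) := by linear_combination 4 * heq
        generalize y - -y = z at hy' hz
        field_simp
        linear_combination (-2 * x) * hz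
  match P, Q with
  | 0, Q => exact ⟨1, by simp; ring, by simp; ring, by simp; ring⟩
  | P, 0 => exact ⟨1, by simp; ring, by simp; ring, by simp; ring⟩
  | .some x₁ y₁ hP, .some x₂ y₂ hQ =>
    have e₁ := (W.equation_iff x₁ y₁).mp hP.1
    have e₂ := (W.equation_iff x₂ y₂).mp hQ.1
    simp only [h₁, h₂, h₃, h₄, zero_mul, add_zero] at e₁ e₂
    by_cases hx : x₁ = x₂
    · rcases (Point.X_eq_iff (h₁ := hP) (h₂ := hQ)).mp hx with h | h
      · obtain ⟨κ, k1, k2⟩ := double x₁ y₁ hP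
        rw [← h, sub_self]
        refine ⟨κ, by simp, ?_, ?_⟩
        · simp at k1 ⊢; linear_combination k1
        · simp at k2 ⊢; linear_combination k2
      · obtain ⟨κ, k1, k2⟩ := double x₁ y₁ hP
        have h' : Point.some x₂ y₂ hQ =
          -Point.some x₁ y₁ hP := by rw [h, neg_neg]
        rw [h', sub_neg_eq_add, add_neg_cancel]
        refine ⟨κ, by simp, ?_, ?_⟩
        · simp at k1 ⊢; linear_combination k1
        · simp at k2 ⊢; linear_combination k2
    · rw [sub_eq_add_neg, Point.neg_some,
        Point.add_of_X_ne hx, Point.add_of_X_ne hx]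
      have hx' : x₁ - x₂ ≠ 0 := sub_ne_zero.mpr hx
      refine ⟨(x₁ - x₂) ^ 2, ?_, ?_, ?_⟩ <;>
      simp only [Point.xRep_some, Matrix.cons_val_zero,
        Matrix.cons_val_one, slope_of_X_ne hx,
          negY, addX,
          h₁, h₂, h₃, zero_mul, add_zero, sub_zero, mul_one]
      · field_simp
        linear_combination 2 * e₁ + 2 * e₂
      · field_simp
        linear_combination (y₁ ^ 2 + x₁ ^ 3 + W.a₆ - 2 * y₂ ^ 2 -
            2 * (x₁ - x₂) ^ 2 * (x₁ + x₂)) * e₁ +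
          (y₂ ^ 2 + x₂ ^ 3 + W.a₆ - 2 * (x₁ ^ 3 + W.a₆) - 2 * (x₁ - x₂) ^ 2 * (x₁ + x₂)) * e₂

end AddSub

/-! ### Values of forms at infinity -/

section TopCoeff

variable {K : Type*} [Field K]

/-- `f` has degree at most `n`, and `c` is its coefficient of degree `n`. -/
def HasTopCoeff (f : K[X]) (n : ℕ) (c : K) : Prop :=
  f.natDegree ≤ n ∧ f.coeff n = c

namespace HasTopCoeff

variable {f g : K[X]} {m n : ℕ} {c d : K}

theorem congr (hf : HasTopCoeff f m c) (hfg : g = f) (hmn : n = m) (hcd : d = c) :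
    HasTopCoeff g n d := by
  subst hfg hmn hcd
  exact hf

theorem mul (hf : HasTopCoeff f m c) (hg : HasTopCoeff g n d) :
    HasTopCoeff (f * g) (m + n) (c * d) :=
  ⟨natDegree_mul_le_of_le hf.1 hg.1, by
    rw [coeff_mul_add_eq_of_natDegree_le hf.1 hg.1, hf.2, hg.2]⟩

theorem pow (hf : HasTopCoeff f n c) (k : ℕ) : HasTopCoeff (f ^ k) (k * n) (c ^ k) :=
  ⟨natDegree_pow_le_of_le k hf.1, by rw [coeff_pow_of_natDegree_le hf.1, hf.2]⟩

theorem add (hf : HasTopCoeff f n c) (hg : HasTopCoeff g n d) : HasTopCoeff (f + g) n (c + d) :=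
  ⟨natDegree_add_le_of_degree_le hf.1 hg.1, by rw [coeff_add, hf.2, hg.2]⟩

theorem sub (hf : HasTopCoeff f n c) (hg : HasTopCoeff g n d) : HasTopCoeff (f - g) n (c - d) :=
  ⟨natDegree_sub_le_of_le hf.1 hg.1 |>.trans_eq (max_self n), by rw [coeff_sub, hf.2, hg.2]⟩

theorem ofNat (k : ℕ) [k.AtLeastTwo] : HasTopCoeff (ofNat(k) : K[X]) 0 (ofNat(k)) :=
  ⟨(natDegree_ofNat k).le, by simp⟩

theorem of_X_pow_mul {k : ℕ} (hf : HasTopCoeff (X ^ k * f) (n + k) c) : HasTopCoeff f n c := by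
  refine ⟨?_, by rw [← hf.2, coeff_X_pow_mul]⟩
  by_cases h0 : f = 0
  · simp [h0]
  · have := hf.1
    rw [natDegree_X_pow_mul k h0] at this
    omega

end HasTopCoeff

end TopCoeff

/-! ### Weights of proportional triples -/

section NormalizedTriple

variable {K : Type*} [Field K]

/-- Bounds `deg u + 4, deg v + 2, deg w ≤ N` for the nonzero ones among `u, v, w`. -/
structure TripleDegreeLE (u v w : K[X]) (N : ℕ) : Prop where
  fst : (X ^ 4 * u).natDegree ≤ N
  snd : (X ^ 2 * v).natDegree ≤ N
  trd : w.natDegree ≤ N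

/-- The polynomials `u, v, w`, of weights `N - 4, N - 2, N`, have no common zero on the
projective line, with the point at infinity included. -/
structure IsNormalizedTriple (u v w : K[X]) (N : ℕ) : Prop extends TripleDegreeLE u v w N where
  eval_ne_zero : ∀ r : K, u.eval r ≠ 0 ∨ v.eval r ≠ 0 ∨ w.eval r ≠ 0
  coeff_ne_zero : (X ^ 4 * u).coeff N ≠ 0 ∨ (X ^ 2 * v).coeff N ≠ 0 ∨ w.coeff N ≠ 0

/-- The gcd of `u, v, w` has no root, hence is a unit, and `g` divides `p` times this gcd. -/
theorem dvd_of_dvd_mul_of_eval_ne_zero [IsAlgClosed K] {u v w g p : K[X]}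
    (h : ∀ r : K, u.eval r ≠ 0 ∨ v.eval r ≠ 0 ∨ w.eval r ≠ 0)
    (hu : g ∣ p * u) (hv : g ∣ p * v) (hw : g ∣ p * w) : g ∣ p := by
  let I : Ideal K[X] := Ideal.span {u, v, w}
  let d := Submodule.IsPrincipal.generator I
  have hdvd : ∀ q ∈ ({u, v, w} : Set K[X]), d ∣ q := fun q hq ↦
    (Submodule.IsPrincipal.mem_iff_generator_dvd I).mp (Ideal.subset_span hq)
  have hd : IsUnit d := by
    by_contra hd
    obtain ⟨r, hr⟩ := IsAlgClosed.exists_root d (fun h0 ↦ hd (isUnit_iff_degree_eq_zero.mpr h0))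
    rcases h r with h | h | h
    · exact h (hr.dvd (hdvd u (by simp)))
    · exact h (hr.dvd (hdvd v (by simp)))
    · exact h (hr.dvd (hdvd w (by simp)))
  have hle : I ≤ Submodule.comap (LinearMap.mulLeft K[X] p) (Ideal.span {g}) := by
    refine Ideal.span_le.mpr ?_
    rintro q (rfl | rfl | rfl) <;> simpa [Ideal.mem_span_singleton]
  have hpd : g ∣ p * d := by
    simpa [Ideal.mem_span_singleton] using hle (Submodule.IsPrincipal.generator_mem I)
  exact hd.dvd_mul_right.mp hpd

/-- Among proportional triples, a normalized one has the smallest weight. -/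
theorem IsNormalizedTriple.le_of_mul_eq_mul [IsAlgClosed K] {u v w u' v' w' g g' : K[X]}
    {N N' : ℕ} (h : IsNormalizedTriple u v w N) (h' : TripleDegreeLE u' v' w' N')
    (hg' : g' ≠ 0) (hu : g * u = g' * u') (hv : g * v = g' * v')
    (hw : g * w = g' * w') (hg : g ≠ 0) : N ≤ N' := by
  obtain ⟨s, rfl⟩ : g' ∣ g := dvd_of_dvd_mul_of_eval_ne_zero h.eval_ne_zero
    ⟨_, hu⟩ ⟨_, hv⟩ ⟨_, hw⟩
  have hs : s ≠ 0 := right_ne_zero_of_mul hg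
  rw [mul_assoc] at hu hv hw
  have hu := mul_left_cancel₀ hg' hu
  have hv := mul_left_cancel₀ hg' hv
  have hw := mul_left_cancel₀ hg' hw
  have key : ∀ q q' : K[X], s * q = q' → q'.natDegree ≤ N' → q.coeff N ≠ 0 → N ≤ N' := by
    rintro q q' rfl hq hc
    have hq0 : q ≠ 0 := by rintro rfl; simp at hc
    rw [natDegree_mul hs hq0] at hq
    have := le_natDegree_of_ne_zero hc
    omega
  rcases h.coeff_ne_zero with hc | hc | hc
  · exact key _ (X ^ 4 * u') (by rw [← hu]; ring) h'.fst hc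
  · exact key _ (X ^ 2 * v') (by rw [← hv]; ring) h'.snd hc
  · exact key _ _ hw h'.trd hc

/-- Proportional normalized triples have the same weight. -/
theorem IsNormalizedTriple.eq_of_mul_eq_mul [IsAlgClosed K] {u v w u' v' w' g g' : K[X]}
    {N N' : ℕ} (h : IsNormalizedTriple u v w N) (h' : IsNormalizedTriple u' v' w' N')
    (hg : g ≠ 0) (hg' : g' ≠ 0) (hu : g * u = g' * u') (hv : g * v = g' * v')
    (hw : g * w = g' * w') : N = N' :=
  le_antisymm (h.le_of_mul_eq_mul h'.toTripleDegreeLE hg' hu hv hw hg)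
    (h'.le_of_mul_eq_mul h.toTripleDegreeLE hg hu.symm hv.symm hw.symm hg')

end NormalizedTriple

/-! ### Normalized `x`-coordinates and singular fibres -/

section NormalizedX

variable {K : Type*} [Field K]

/-- `a / b` is a projective `x`-coordinate in lowest terms of a `K(t)`-rational point on
`y² = x³ + B`, and the forms `a, b` of weights `h, h - 2` have no common zero at infinity. -/
structure IsNormalizedX (B a b : K[X]) (h : ℕ) : Prop where
  coprime : IsCoprime a b
  natDegree_fst : a.natDegree ≤ h
  natDegree_snd : (X ^ 2 * b).natDegree ≤ h
  coeff_ne_zero : a.coeff h ≠ 0 ∨ (X ^ 2 * b).coeff h ≠ 0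
  exists_sq_num : ∃ e : K[X], Associated (e ^ 2) (a ^ 3 + B * b ^ 3)
  exists_sq_denom : ∃ f : K[X], Associated (f ^ 2) (b ^ 3)

namespace IsNormalizedX

variable {B a b a₁ b₁ a₂ b₂ : K[X]} {h h₁ h₂ : ℕ}

theorem hasTopCoeff_fst (H : IsNormalizedX B a b h) : HasTopCoeff a h (a.coeff h) :=
  ⟨H.natDegree_fst, rfl⟩

theorem hasTopCoeff_snd (H : IsNormalizedX B a b h) :
    HasTopCoeff (X ^ 2 * b) h ((X ^ 2 * b).coeff h) :=
  ⟨H.natDegree_snd, rfl⟩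

theorem eval_ne_zero (H : IsNormalizedX B a b h) (r : K) : a.eval r ≠ 0 ∨ b.eval r ≠ 0 := by
  obtain ⟨s, t, hst⟩ := H.coprime
  by_contra! hc
  have := congrArg (eval r) hst
  simp [hc.1, hc.2] at this

/-- The pair of `x`-coordinates of two points gives a normalized triple (the Gauss lemma). -/
theorem isNormalizedTriple_sym (H₁ : IsNormalizedX B a₁ b₁ h₁) (H₂ : IsNormalizedX B a₂ b₂ h₂) :
    IsNormalizedTriple (b₁ * b₂) (a₁ * b₂ + a₂ * b₁) (a₁ * a₂) (h₁ + h₂) := by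
  have t₀ := H₁.hasTopCoeff_snd.mul H₂.hasTopCoeff_snd
  have t₁ := (H₁.hasTopCoeff_fst.mul H₂.hasTopCoeff_snd).add
    (H₁.hasTopCoeff_snd.mul H₂.hasTopCoeff_fst)
  have t₂ := H₁.hasTopCoeff_fst.mul H₂.hasTopCoeff_fst
  rw [show X ^ 2 * b₁ * (X ^ 2 * b₂) = X ^ 4 * (b₁ * b₂) by ring] at t₀
  rw [show a₁ * (X ^ 2 * b₂) + X ^ 2 * b₁ * a₂ = X ^ 2 * (a₁ * b₂ + a₂ * b₁) by ring] at t₁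
  have field : ∀ α₁ β₁ α₂ β₂ : K, (α₁ ≠ 0 ∨ β₁ ≠ 0) → (α₂ ≠ 0 ∨ β₂ ≠ 0) →
      β₁ * β₂ ≠ 0 ∨ α₁ * β₂ + β₁ * α₂ ≠ 0 ∨ α₁ * α₂ ≠ 0 := by
    intro α₁ β₁ α₂ β₂ h₁ h₂
    by_contra! hc
    obtain ⟨c₀, c₁, c₂⟩ := hc
    rcases mul_eq_zero.mp c₀ with c | c <;> rcases mul_eq_zero.mp c₂ with d | d <;> simp_all
  refine ⟨⟨t₀.1, t₁.1, t₂.1⟩, fun r ↦ ?_, ?_⟩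
  · have := field _ _ _ _ (H₁.eval_ne_zero r) (H₂.eval_ne_zero r)
    simpa only [eval_mul, eval_add, mul_comm (eval r a₂)] using this
  · rw [t₀.2, t₁.2, t₂.2]
    exact field _ _ _ _ H₁.coeff_ne_zero H₂.coeff_ne_zero

/-- At a place of additive reduction a point does not reduce to the singular point. -/
theorem eval_ne_zero_of_isRoot (H : IsNormalizedX B a b h) (hB : B.Separable) {r : K}
    (hr : B.eval r = 0) : a.eval r ≠ 0 := by
  intro ha
  have hb : b.eval r ≠ 0 := (H.eval_ne_zero r).resolve_left (not_not_intro ha)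
  obtain ⟨e, he⟩ := H.exists_sq_num
  have ha' := dvd_iff_isRoot.mpr ha
  have hr' := dvd_iff_isRoot.mpr hr
  have hp : Prime (X - C r) := prime_X_sub_C r
  have h1 : X - C r ∣ e ^ 2 := he.dvd_iff_dvd_right.mpr
    (dvd_add (ha'.trans (dvd_pow_self _ three_ne_zero)) (hr'.mul_right _))
  -- A square vanishing at `r` vanishes doubly. As `a` vanishes there and `b` does not, `r` would be
  -- a double root of `B`.
  have h2 : (X - C r) ^ 2 ∣ a ^ 3 + B * b ^ 3 :=
    he.dvd_iff_dvd_right.mp (pow_dvd_pow_of_dvd (hp.dvd_of_dvd_pow h1) 2)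
  have h3 : (X - C r) ^ 2 ∣ B * b ^ 3 := by
    refine (dvd_add_right ?_).mp h2
    exact (pow_dvd_pow_of_dvd ha' 2).trans (pow_dvd_pow _ (by norm_num))
  have hcop : IsCoprime ((X - C r) ^ 2) (b ^ 3) := by
    refine IsCoprime.pow ((hp.irreducible.coprime_iff_not_dvd).mpr fun hd ↦ hb ?_)
    exact dvd_iff_isRoot.mp hd
  have h4 := hcop.dvd_of_dvd_mul_right h3
  rw [pow_two] at h4
  exact hp.not_isUnit (hB.squarefree _ h4)

/-- If the fibre at infinity is of additive reduction, a point does not reduce to its singular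
point. -/
theorem coeff_ne_zero_of_natDegree_eq_five (H : IsNormalizedX B a b h) (hB : B.natDegree = 5) :
    a.coeff h ≠ 0 := by
  intro ha
  have hb := H.coeff_ne_zero.resolve_left (not_not_intro ha)
  have hb0 : b ≠ 0 := by rintro rfl; simp at hb
  have hB0 : B ≠ 0 := by rintro rfl; simp at hB
  have hbd : b.natDegree + 2 = h := by
    rw [← natDegree_X_pow_mul 2 hb0]
    exact le_antisymm H.natDegree_snd (le_natDegree_of_ne_zero hb)
  have had : a.natDegree < h := by
    refine lt_of_le_of_ne H.natDegree_fst fun hh ↦ ?_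
    rw [← hh, coeff_natDegree, leadingCoeff_eq_zero] at ha
    subst ha
    simp at hh
    omega
  have hBb : (B * b ^ 3).natDegree = 5 + 3 * b.natDegree := by
    rw [natDegree_mul hB0 (pow_ne_zero _ hb0), natDegree_pow, hB]
  have hsum : (a ^ 3 + B * b ^ 3).natDegree = 5 + 3 * b.natDegree := by
    rw [natDegree_add_eq_right_of_natDegree_lt, hBb]
    rw [hBb, natDegree_pow]
    omega
  -- Parity contradiction: both `5 + 3 deg b` and `3 deg b` are degrees of squares.
  obtain ⟨e, he⟩ := H.exists_sq_num
  obtain ⟨f, hf⟩ := H.exists_sq_denom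
  have he := natDegree_eq_of_degree_eq (degree_eq_degree_of_associated he)
  have hf := natDegree_eq_of_degree_eq (degree_eq_degree_of_associated hf)
  rw [natDegree_pow, hsum] at he
  rw [natDegree_pow, natDegree_pow] at hf
  omega

/-- The formulas for the `x`-coordinates of `P + Q` and `P - Q` produce a normalized triple. -/
theorem isNormalizedTriple_addSub (h2 : (2 : K) ≠ 0) (h3 : (3 : K) ≠ 0) (hB : B.Separable)
    (hdeg : B.natDegree = 5 ∨ B.natDegree = 6)
    (H₁ : IsNormalizedX B a₁ b₁ h₁) (H₂ : IsNormalizedX B a₂ b₂ h₂) :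
    IsNormalizedTriple ((a₁ * b₂ - a₂ * b₁) ^ 2)
      (2 * (a₁ * a₂ * (a₁ * b₂ + a₂ * b₁) + 2 * B * b₁ ^ 2 * b₂ ^ 2))
      (a₁ ^ 2 * a₂ ^ 2 - 4 * B * b₁ * b₂ * (a₁ * b₂ + a₂ * b₁)) (2 * h₁ + 2 * h₂) := by
  -- Pointwise statement, applied to values at finite `r` and to top coefficients at infinity. A
  -- common zero has equal `x`-coordinates, and the duplication formula then gives `9 x ^ 4 = 0`, so
  -- `x = β = 0`.
  have field : ∀ β α₁ β₁ α₂ β₂ : K, (α₁ ≠ 0 ∨ β₁ ≠ 0) → (α₂ ≠ 0 ∨ β₂ ≠ 0) →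
      (β = 0 → α₁ ≠ 0) → (α₁ * β₂ - α₂ * β₁) ^ 2 ≠ 0 ∨
        2 * (α₁ * α₂ * (α₁ * β₂ + α₂ * β₁) + 2 * β * β₁ ^ 2 * β₂ ^ 2) ≠ 0 ∨
        α₁ ^ 2 * α₂ ^ 2 - 4 * β * β₁ * β₂ * (α₁ * β₂ + α₂ * β₁) ≠ 0 := by
    intro β α₁ β₁ α₂ β₂ n₁ n₂ hβ
    by_contra! hc
    obtain ⟨c₀, c₁, c₂⟩ := hc
    have c₀ : α₁ * β₂ - α₂ * β₁ = 0 := pow_eq_zero_iff two_ne_zero |>.mp c₀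
    by_cases hb₁ : β₁ = 0
    · subst hb₁
      have ha₁ := n₁.resolve_right (not_not_intro rfl)
      have hb₂ : β₂ = 0 := by simpa [ha₁] using c₀
      subst hb₂
      have ha₂ := n₂.resolve_right (not_not_intro rfl)
      simp [ha₁, ha₂] at c₂
    have hb₂ : β₂ ≠ 0 := by
      rintro rfl
      have ha₂ := n₂.resolve_right (not_not_intro rfl)
      simp [ha₂, hb₁] at c₀
    obtain ⟨x, rfl⟩ : ∃ x, α₁ = x * β₁ := ⟨α₁ / β₁, by field_simp⟩
    obtain rfl : α₂ = x * β₂ := by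
      apply mul_right_cancel₀ hb₁
      linear_combination -c₀
    have d₁ : x ^ 3 + β = 0 := by
      have : 2 * 2 * (β₁ ^ 2 * β₂ ^ 2) * (x ^ 3 + β) = 0 := by linear_combination c₁
      simpa [h2, hb₁, hb₂] using this
    have d₂ : x ^ 4 - 8 * β * x = 0 := by
      have : (β₁ ^ 2 * β₂ ^ 2) * (x ^ 4 - 8 * β * x) = 0 := by linear_combination c₂
      simpa [hb₁, hb₂] using this
    have d₃ : 3 * 3 * x ^ 4 = 0 := by linear_combination d₂ + 8 * x * d₁
    have hx : x = 0 := by simpa [h3] using d₃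
    subst hx
    exact hβ (by simpa using d₁) (zero_mul _)
  have A₁ := H₁.hasTopCoeff_fst
  have A₂ := H₂.hasTopCoeff_fst
  have B₁ := H₁.hasTopCoeff_snd
  have B₂ := H₂.hasTopCoeff_snd
  have n₁ := H₁.coeff_ne_zero
  have n₂ := H₂.coeff_ne_zero
  have nB : B.coeff 6 = 0 → a₁.coeff h₁ ≠ 0 := fun h6 ↦ by
    refine H₁.coeff_ne_zero_of_natDegree_eq_five (hdeg.resolve_right fun h ↦ ?_)
    rw [← h, coeff_natDegree, leadingCoeff_eq_zero] at h6
    simp [h6] at h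
  have T : HasTopCoeff B 6 (B.coeff 6) := ⟨by omega, rfl⟩
  generalize a₁.coeff h₁ = α₁ at A₁ n₁ nB
  generalize a₂.coeff h₂ = α₂ at A₂ n₂
  generalize (X ^ 2 * b₁).coeff h₁ = β₁ at B₁ n₁
  generalize (X ^ 2 * b₂).coeff h₂ = β₂ at B₂ n₂
  generalize B.coeff 6 = β at T nB
  have S := (A₁.mul B₂).add (add_comm h₂ h₁ ▸ A₂.mul B₁)
  have N2 := HasTopCoeff.ofNat (K := K) 2
  have N4 := HasTopCoeff.ofNat (K := K) 4
  have t₀ : HasTopCoeff (X ^ 4 * (a₁ * b₂ - a₂ * b₁) ^ 2) (2 * h₁ + 2 * h₂)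
      ((α₁ * β₂ - α₂ * β₁) ^ 2) :=
    (((A₁.mul B₂).sub (add_comm h₂ h₁ ▸ A₂.mul B₁)).pow 2).congr (by ring) (by ring) rfl
  have t₁ : HasTopCoeff (X ^ 2 * (2 * (a₁ * a₂ * (a₁ * b₂ + a₂ * b₁) +
      2 * B * b₁ ^ 2 * b₂ ^ 2))) (2 * h₁ + 2 * h₂)
      (2 * (α₁ * α₂ * (α₁ * β₂ + α₂ * β₁) + 2 * β * β₁ ^ 2 * β₂ ^ 2)) := by
    -- Each `b` is bounded only through `X ^ 2 * b`; the surplus `X ^ 6` cancels against the weight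
    -- 6 of `B`.
    have q : HasTopCoeff (2 * (X ^ 2 * (B * b₁ ^ 2 * b₂ ^ 2))) (h₁ + h₂ + (h₁ + h₂))
        (2 * (β * β₁ ^ 2 * β₂ ^ 2)) :=
      HasTopCoeff.of_X_pow_mul (k := 6) <|
        (N2.mul ((T.mul (B₁.pow 2)).mul (B₂.pow 2))).congr (by ring) (by ring) rfl
    exact (N2.mul (((A₁.mul A₂).mul S).add q)).congr (by ring) (by ring) (by ring)
  have t₂ : HasTopCoeff (a₁ ^ 2 * a₂ ^ 2 - 4 * B * b₁ * b₂ * (a₁ * b₂ + a₂ * b₁))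
      (2 * h₁ + 2 * h₂) (α₁ ^ 2 * α₂ ^ 2 - 4 * β * β₁ * β₂ * (α₁ * β₂ + α₂ * β₁)) := by
    have q : HasTopCoeff (4 * B * b₁ * b₂ * (a₁ * b₂ + a₂ * b₁)) (2 * h₁ + 2 * h₂)
        (4 * β * β₁ * β₂ * (α₁ * β₂ + α₂ * β₁)) :=
      HasTopCoeff.of_X_pow_mul (k := 6) <|
        ((((N4.mul T).mul B₁).mul B₂).mul S).congr (by ring) (by ring) rfl
    exact ((A₁.pow 2).mul (A₂.pow 2)).sub q
  refine ⟨⟨t₀.1, t₁.1, t₂.1⟩, fun r ↦ ?_, ?_⟩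
  · have := field _ _ _ _ _ (H₁.eval_ne_zero r) (H₂.eval_ne_zero r)
      (H₁.eval_ne_zero_of_isRoot hB)
    simpa only [eval_mul, eval_add, eval_sub, eval_pow, eval_ofNat] using this
  · rw [t₀.2, t₁.2, t₂.2]
    exact field _ _ _ _ _ n₁ n₂ nB

end IsNormalizedX

end NormalizedX

/-! ### From points to the parallelogram law -/

section Points

variable {K : Type*} [Field K]

theorem associated_of_mul_eq_mul_of_isCoprime {R : Type*} [CommRing R] [IsDomain R]
    {p q p' q' : R} (h : IsCoprime p q) (h' : IsCoprime p' q') (e : p * q' = p' * q) :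
    Associated p p' ∧ Associated q q' := by
  refine ⟨associated_of_dvd_dvd ?_ ?_, associated_of_dvd_dvd ?_ ?_⟩
  · exact h.dvd_of_dvd_mul_right (e ▸ dvd_mul_right p q')
  · exact h'.dvd_of_dvd_mul_right (e ▸ dvd_mul_right p' q)
  · exact h.symm.dvd_of_dvd_mul_left (e ▸ dvd_mul_left q p')
  · exact h'.symm.dvd_of_dvd_mul_left (e ▸ dvd_mul_left q' p)

/-- The numerators and denominators in lowest terms of a solution of `y² = x³ + B` in `K(t)`. -/
theorem associated_num_denom_sq {B : K[X]} {x y : RatFunc K}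
    (h : y ^ 2 = x ^ 3 + algebraMap K[X] (RatFunc K) B) :
    Associated (y.num ^ 2) (x.num ^ 3 + B * x.denom ^ 3) ∧
      Associated (y.denom ^ 2) (x.denom ^ 3) := by
  refine associated_of_mul_eq_mul_of_isCoprime y.isCoprime_num_denom.pow ?_ ?_
  · exact x.isCoprime_num_denom.pow.add_mul_right_left B
  · apply RatFunc.algebraMap_injective K
    have hx : algebraMap K[X] (RatFunc K) x.denom ≠ 0 :=
      RatFunc.algebraMap_ne_zero x.denom_ne_zero
    have hy : algebraMap K[X] (RatFunc K) y.denom ≠ 0 :=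
      RatFunc.algebraMap_ne_zero y.denom_ne_zero
    have ex := x.num_div_denom
    have ey := y.num_div_denom
    rw [div_eq_iff hx] at ex
    rw [div_eq_iff hy] at ey
    simp only [map_mul, map_add, map_pow, ex, ey]
    linear_combination (algebraMap K[X] (RatFunc K) x.denom ^ 3 *
      algebraMap K[X] (RatFunc K) y.denom ^ 2) * h

/-- The naive height of an affine point in terms of the numerator and denominator of its
`x`-coordinate. -/
theorem max_ratFuncMapDegree_eq {B : K[X]} (hB : B.natDegree = 5 ∨ B.natDegree = 6)
    {x y : RatFunc K} (h : y ^ 2 = x ^ 3 + algebraMap K[X] (RatFunc K) B) :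
    max (ratFuncMapDegree x : ℝ) ((2 / 3 : ℝ) * (ratFuncMapDegree y : ℝ)) =
      (max x.num.natDegree (x.denom.natDegree + 2) : ℕ) := by
  obtain ⟨hn, hd⟩ := associated_num_denom_sq h
  have hn := natDegree_eq_of_degree_eq (degree_eq_degree_of_associated hn)
  have hd := natDegree_eq_of_degree_eq (degree_eq_degree_of_associated hd)
  have hB0 : B ≠ 0 := by rintro rfl; simp at hB
  have hBd : (B * x.denom ^ 3).natDegree = B.natDegree + 3 * x.denom.natDegree := by
    rw [natDegree_mul hB0 (pow_ne_zero _ x.denom_ne_zero), natDegree_pow]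
  have hle := natDegree_add_le (x.num ^ 3) (B * x.denom ^ 3)
  have hlt : x.num.natDegree < x.denom.natDegree + 2 →
      (x.num ^ 3 + B * x.denom ^ 3).natDegree = B.natDegree + 3 * x.denom.natDegree := by
    intro hlt
    rw [natDegree_add_eq_right_of_natDegree_lt, hBd]
    rw [hBd, natDegree_pow]
    omega
  rw [hBd, natDegree_pow] at hle
  rw [← hn, natDegree_pow] at hle hlt
  rw [natDegree_pow, natDegree_pow] at hd
  set H := max x.num.natDegree (x.denom.natDegree + 2) with hH
  -- If `deg x.num < deg x.denom + 2`, the term with `B` dominates; parity then forces `deg B = 6`,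
  -- and `y` attains the maximum. Otherwise `x` does.
  have key : 3 * ratFuncMapDegree x ≤ 3 * H ∧ 2 * ratFuncMapDegree y ≤ 3 * H ∧
      (3 * ratFuncMapDegree x = 3 * H ∨ 2 * ratFuncMapDegree y = 3 * H) := by
    unfold ratFuncMapDegree
    omega
  obtain ⟨k₁, k₂, k₃⟩ := key
  have k₁ : (3 * ratFuncMapDegree x : ℝ) ≤ 3 * H := by exact_mod_cast k₁
  have k₂ : (2 * ratFuncMapDegree y : ℝ) ≤ 3 * H := by exact_mod_cast k₂
  have k₃ : (3 * ratFuncMapDegree x : ℝ) = 3 * H ∨ (2 * ratFuncMapDegree y : ℝ) = 3 * H := by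
    exact_mod_cast k₃
  refine le_antisymm (max_le (by linarith) (by linarith)) ?_
  rcases k₃ with k | k
  · exact le_max_of_le_left (by linarith)
  · exact le_max_of_le_right (by linarith)

variable {k : Type*} [Field k] [Algebra k K] {S : k[X]}

/-- Every point has a normalized projective `x`-coordinate, whose weight is the naive height. -/
theorem exists_isNormalizedX (hS : S.natDegree = 5 ∨ S.natDegree = 6)
    (P : (sexticCurve K S).Point) :
    ∃ (a b : K[X]) (h : ℕ) (d : RatFunc K), d ≠ 0 ∧
      algebraMap K[X] (RatFunc K) a = d * P.xRep 0 ∧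
      algebraMap K[X] (RatFunc K) b = d * P.xRep 1 ∧
      IsNormalizedX (S.map (algebraMap k K)) a b h ∧ naiveHeight (sexticCurve K S) P = h := by
  have hB : (S.map (algebraMap k K)).natDegree = 5 ∨ (S.map (algebraMap k K)).natDegree = 6 := by
    rwa [natDegree_map]
  match P with
  | 0 =>
    refine ⟨1, 0, 0, 1, one_ne_zero, by simp, by simp,
      ⟨isCoprime_one_left, by simp, by simp, by simp, ⟨1, by simp⟩, ⟨0, by simp⟩⟩, ?_⟩
    exact Nat.cast_zero.symm
  | .some x y hxy =>
    have heq := ((sexticCurve K S).equation_iff x y).mp hxy.1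
    simp only [sexticCurve, zero_mul, add_zero] at heq
    have hx : algebraMap K[X] (RatFunc K) x.denom ≠ 0 :=
      RatFunc.algebraMap_ne_zero x.denom_ne_zero
    obtain ⟨hn, hd⟩ := associated_num_denom_sq heq
    have hX := natDegree_X_pow_mul 2 x.denom_ne_zero
    refine ⟨x.num, x.denom, max x.num.natDegree (x.denom.natDegree + 2), _, hx, ?_, ?_,
      ⟨x.isCoprime_num_denom, le_max_left _ _, ?_, ?_, ⟨_, hn⟩, ⟨_, hd⟩⟩,
      max_ratFuncMapDegree_eq hB heq⟩
    · rw [WeierstrassCurve.Affine.Point.xRep_some, Matrix.cons_val_zero, mul_comm,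
        ← div_eq_iff hx, x.num_div_denom]
    · simp
    · exact hX.le.trans (le_max_right _ _)
    · rcases le_total x.num.natDegree (x.denom.natDegree + 2) with h | h
      · right
        rw [max_eq_right h, ← hX, coeff_natDegree, leadingCoeff_ne_zero]
        exact mul_ne_zero (pow_ne_zero _ X_ne_zero) x.denom_ne_zero
      · left
        rw [max_eq_left h, coeff_natDegree, leadingCoeff_ne_zero]
        intro h0
        rw [h0] at h
        simp at h

/-- The naive height on `y² = x³ + S(t)` satisfies the parallelogram law. -/
theorem naiveHeight_parallelogram [IsAlgClosed K] [DecidableEq (RatFunc K)] (h2 : (2 : K) ≠ 0)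
    (h3 : (3 : K) ≠ 0) (hS : S.Separable) (hdeg : S.natDegree = 5 ∨ S.natDegree = 6)
    (P Q : (sexticCurve K S).Point) :
    naiveHeight (sexticCurve K S) (P + Q) + naiveHeight (sexticCurve K S) (P - Q) =
      2 * naiveHeight (sexticCurve K S) P + 2 * naiveHeight (sexticCurve K S) Q := by
  obtain ⟨a₁, b₁, n₁, d₁, hd₁, ha₁, hb₁, H₁, e₁⟩ := exists_isNormalizedX hdeg P
  obtain ⟨a₂, b₂, n₂, d₂, hd₂, ha₂, hb₂, H₂, e₂⟩ := exists_isNormalizedX hdeg Q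
  obtain ⟨a₃, b₃, n₃, d₃, hd₃, ha₃, hb₃, H₃, e₃⟩ := exists_isNormalizedX hdeg (P + Q)
  obtain ⟨a₄, b₄, n₄, d₄, hd₄, ha₄, hb₄, H₄, e₄⟩ := exists_isNormalizedX hdeg (P - Q)
  have T := H₃.isNormalizedTriple_sym H₄
  have T' := IsNormalizedX.isNormalizedTriple_addSub h2 h3 (hS.map (f := algebraMap k K))
    (by rwa [natDegree_map]) H₁ H₂
  obtain ⟨κ, k₀, k₁, k₂⟩ := exists_mul_xRep_add_sub (sexticCurve K S) rfl rfl rfl rfl P Q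
  rw [show (sexticCurve K S).a₆ = algebraMap K[X] (RatFunc K) (S.map (algebraMap k K)) from rfl]
    at k₁ k₂
  obtain ⟨ρ, hρ⟩ : ∃ ρ, ρ * (d₃ * d₄) = κ * d₁ ^ 2 * d₂ ^ 2 :=
    ⟨κ * d₁ ^ 2 * d₂ ^ 2 / (d₃ * d₄), div_mul_cancel₀ _ (mul_ne_zero hd₃ hd₄)⟩
  have hden : algebraMap K[X] (RatFunc K) ρ.denom ≠ 0 :=
    RatFunc.algebraMap_ne_zero ρ.denom_ne_zero
  have hnum : algebraMap K[X] (RatFunc K) ρ.num = ρ * algebraMap K[X] (RatFunc K) ρ.denom := by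
    rw [← div_eq_iff hden, ρ.num_div_denom]
  have clear : ∀ p q : K[X], ρ * algebraMap K[X] (RatFunc K) p = algebraMap K[X] (RatFunc K) q →
      ρ.num * p = ρ.denom * q := by
    intro p q hpq
    apply RatFunc.algebraMap_injective K
    rw [map_mul, map_mul, hnum, ← hpq]
    ring
  have t₀ := clear (b₃ * b₄) ((a₁ * b₂ - a₂ * b₁) ^ 2) (by
    simp only [map_mul, map_sub, map_pow, ha₁, ha₂, hb₁, hb₂, hb₃, hb₄]
    linear_combination ((P + Q).xRep 1 * (P - Q).xRep 1) * hρ + d₁ ^ 2 * d₂ ^ 2 * k₀)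
  have t₁ := clear (a₃ * b₄ + a₄ * b₃)
    (2 * (a₁ * a₂ * (a₁ * b₂ + a₂ * b₁) + 2 * S.map (algebraMap k K) * b₁ ^ 2 * b₂ ^ 2)) (by
    simp only [map_mul, map_add, map_pow, map_ofNat, ha₁, ha₂, ha₃, ha₄, hb₁, hb₂, hb₃, hb₄]
    linear_combination ((P + Q).xRep 0 * (P - Q).xRep 1 + (P - Q).xRep 0 * (P + Q).xRep 1) * hρ +
      d₁ ^ 2 * d₂ ^ 2 * k₁)
  have t₂ := clear (a₃ * a₄)
    (a₁ ^ 2 * a₂ ^ 2 - 4 * S.map (algebraMap k K) * b₁ * b₂ * (a₁ * b₂ + a₂ * b₁)) (by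
    simp only [map_mul, map_add, map_sub, map_pow, map_ofNat, ha₁, ha₂, ha₃, ha₄, hb₁, hb₂]
    linear_combination ((P + Q).xRep 0 * (P - Q).xRep 0) * hρ + d₁ ^ 2 * d₂ ^ 2 * k₂)
  -- The formulas do not assert `κ ≠ 0`; it is not needed, since `ρ = 0` would make the normalized
  -- triple `T'` vanish identically.
  have hρ0 : ρ.num ≠ 0 := by
    intro h0
    rw [h0, zero_mul, eq_comm, mul_eq_zero, or_iff_right ρ.denom_ne_zero] at t₀ t₁ t₂
    have := T'.eval_ne_zero 0
    simp [t₀, t₁, t₂] at this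
  have hN := T.eq_of_mul_eq_mul T' hρ0 ρ.denom_ne_zero t₀ t₁ t₂
  rw [e₁, e₂, e₃, e₄]
  exact_mod_cast hN

end Points

/-! ### The canonical height -/

theorem mainTheorem6 {k K : Type*} [Field k] [Field K] [Algebra k K] [IsAlgClosure k K]
    [DecidableEq (RatFunc K)] (h2 : (2 : k) ≠ 0) (h3 : (3 : k) ≠ 0)
    (S : k[X]) (hS : S.Separable) (hdeg : S.natDegree = 5 ∨ S.natDegree = 6) :
    (∃! hhat : QuadraticMap ℤ (sexticCurve K S).Point ℝ,
      IsCanonicalHeight (sexticCurve K S) hhat) ∧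
    ∀ hhat : QuadraticMap ℤ (sexticCurve K S).Point ℝ,
      IsCanonicalHeight (sexticCurve K S) hhat →
        (∀ (x y : RatFunc K) (hxy : (sexticCurve K S).Nonsingular x y),
          hhat (.some x y hxy) =
            max (ratFuncMapDegree x : ℝ) ((2 / 3 : ℝ) * (ratFuncMapDegree y : ℝ))) ∧
        ∀ P : (sexticCurve K S).Point, hhat P = naiveHeight (sexticCurve K S) P := by
  have : IsAlgClosed K := IsAlgClosure.isAlgClosed k
  have h2' : (2 : K) ≠ 0 := by
    rw [← map_ofNat (algebraMap k K) 2]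
    exact (map_ne_zero (algebraMap k K)).mpr h2
  have h3' : (3 : K) ≠ 0 := by
    rw [← map_ofNat (algebraMap k K) 3]
    exact (map_ne_zero (algebraMap k K)).mpr h3
  obtain ⟨q, hq⟩ := exists_quadraticMap_of_parallelogram (naiveHeight (sexticCurve K S))
    (naiveHeight_parallelogram h2' h3' hS hdeg)
  have huniq : ∀ hhat : QuadraticMap ℤ (sexticCurve K S).Point ℝ,
      IsCanonicalHeight (sexticCurve K S) hhat → ∀ P, hhat P = q P := by
    rintro hhat ⟨C, hC⟩ P
    refine sub_eq_zero.mp (QuadraticMap.eq_zero_of_bounded (hhat - q) C (fun P ↦ ?_) P)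
    rw [sub_apply, hq]
    exact hC P
  have hall : ∀ hhat : QuadraticMap ℤ (sexticCurve K S).Point ℝ,
      IsCanonicalHeight (sexticCurve K S) hhat → ∀ P, hhat P = naiveHeight (sexticCurve K S) P :=
    fun hhat hh P ↦ (huniq hhat hh P).trans (hq P)
  refine ⟨⟨q, ⟨0, fun P ↦ by rw [hq]; simp⟩, fun q' hq' ↦ QuadraticMap.ext (huniq q' hq')⟩,
    fun hhat hh ↦ ⟨fun x y hxy ↦ hall hhat hh _, hall hhat hh⟩⟩
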